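/- Let $\Gamma$ be the incidence graph of the projective plane of order $2$ (the Fano plane $PG(2,2)$): its $14$ nodes are the $7$ points and the $7$ lines, and a point is joined to a line exactly when it lies on it. Let $W(\Gamma)$ be the Coxeter group of $\Gamma$, generated by the nodes subject to $\alpha^2=1$ for every node $\alpha$, $(\alpha\beta)^2=1$ for distinct unjoined nodes and $(\alpha\beta)^3=1$ for joined nodes. A free $8$-gon of $\Gamma$ is an induced subgraph isomorphic to the cycle of length $8$. The Coxeter group of the $8$-cycle is the affine Coxeter group $\mathbb{Z}^7{:}S_8$ of type $\tilde A_7$; its translation subgroup $\mathbb{Z}^7$ consists of the elements that act as translations when the group is realized by affine reflections, the eight generators acting on $\mathbb{R}^8$ as the reflections in the hyperplanes $x_i=x_{i+1}$ ($0\le i\le 6$) and $x_7=x_0-1$. To deflate a free $8$-gon is to impose on $W(\Gamma)$ the relations that the image in $W(\Gamma)$ of every element of this translation subgroup is trivial. Then the group obtained from $W(\Gamma)$ by deflating all free $8$-gons of $\Gamma$, that is, the quotient of $W(\Gamma)$ by the normal closure of the translations of all its free $8$-gons, is isomorphic to the finite group $O_8^-(2){:}2$ (Atlas notation), i.e. to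 the full orthogonal group $GO_8^-(2)$ of all linear isometries of the quadratic form $x_0x_1+x_2x_3+x_4x_5+x_6^2+x_6x_7+x_7^2$ of minus type on $\mathbb{F}_2^8$. -/

import Mathlib

open scoped LinearAlgebra.Projectivization

noncomputable section

namespace Deflation

/-- The simply laced Coxeter matrix of a graph: nodes are involutions, unjoined nodes commute,
and the product of two joined nodes has order `3`. -/
def coxeterMatrix {V : Type*} (Γ : SimpleGraph V) : CoxeterMatrix V where
  M := open Classical in Matrix.of fun i j => if i = j then 1 else if Γ.Adj i j then 3 else 2
  isSymm := by
    ext i j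
    simp only [Matrix.transpose_apply, Matrix.of_apply]
    classical exact if_congr eq_comm rfl (if_congr (Γ.adj_comm j i) rfl rfl)
  diagonal i := by simp
  off_diagonal i j h := by
    simp only [Matrix.of_apply, h, if_false]
    split_ifs <;> decide

open Classical in
theorem coxeterMatrix_apply {V : Type*} (Γ : SimpleGraph V) (i j : V) :
    coxeterMatrix Γ i j = if i = j then 1 else if Γ.Adj i j then 3 else 2 := rfl

/-- The Coxeter group of a graph. -/
abbrev CoxeterGroup {V : Type*} (Γ : SimpleGraph V) : Type _ := (coxeterMatrix Γ).Group

/-- The homomorphism of Coxeter groups induced by the inclusion of a free (i.e. induced)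
subgraph, sending each generator to the corresponding generator. -/
def inducedHom {V W : Type*} {Γ : SimpleGraph V} {Δ : SimpleGraph W} (f : Γ ↪g Δ) :
    CoxeterGroup Γ →* CoxeterGroup Δ :=
  (coxeterMatrix Γ).toCoxeterSystem.lift ⟨fun i => (coxeterMatrix Δ).simple (f i), by
    intro i j
    have h : coxeterMatrix Γ i j = coxeterMatrix Δ (f i) (f j) := by
      simp only [coxeterMatrix_apply]
      classical exact if_congr f.injective.eq_iff.symm rfl (if_congr f.map_adj_iff.symm rfl rfl)
    rw [h]
    exact (coxeterMatrix Δ).toCoxeterSystem.simple_mul_simple_pow (f i) (f j)⟩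

/-- The simple roots of the affine Weyl group of type `A₇`, as affine functions on `ℝ⁸`:
`x₀ - x₁, …, x₆ - x₇` and `x₇ - x₀ + 1`. -/
def affineRoot (i : Fin 8) (x : Fin 8 → ℝ) : ℝ :=
  x i - x (i + 1) + if i = 7 then 1 else 0

/-- The gradients `eᵢ - eᵢ₊₁` (indices mod `8`) of the affine simple roots. -/
def rootVector (i : Fin 8) : Fin 8 → ℝ := Pi.single i 1 - Pi.single (i + 1) 1

theorem affineRoot_sub_smul (i j : Fin 8) (x : Fin 8 → ℝ) (c : ℝ) :
    affineRoot i (x - c • rootVector j) = affineRoot i x -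
      c * (if i = j then 2 else if (SimpleGraph.cycleGraph 8).Adj i j then -1 else 0) := by
  fin_cases i <;> fin_cases j <;>
    simp +decide [affineRoot, rootVector] <;> ring

/-- The reflection of `ℝ⁸` in the hyperplane on which the `i`-th affine simple root vanishes. -/
def affineReflection (i : Fin 8) : Equiv.Perm (Fin 8 → ℝ) :=
  Function.Involutive.toPerm (fun x => x - affineRoot i x • rootVector i) (by
    intro x
    simp only [affineRoot_sub_smul, if_true]
    module)

theorem affineReflection_apply (i : Fin 8) (x : Fin 8 → ℝ) :
    affineReflection i x = x - affineRoot i x • rootVector i := rfl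

/-- The action of the Coxeter group of the `8`-gon, i.e. the affine Coxeter group of type `A₇`,
on `ℝ⁸` as a group generated by affine reflections. -/
def affineAction : CoxeterGroup (SimpleGraph.cycleGraph 8) →* Equiv.Perm (Fin 8 → ℝ) :=
  (coxeterMatrix (SimpleGraph.cycleGraph 8)).toCoxeterSystem.lift ⟨affineReflection, by
    intro i j
    ext1 x
    by_cases hij : i = j
    · subst hij
      simp only [coxeterMatrix_apply, if_true, pow_one]
      exact (affineReflection i).left_inv x
    · have hji : ¬ j = i := fun h => hij h.symm
      by_cases h : (SimpleGraph.cycleGraph 8).Adj i j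
      · have h' := h.symm
        simp only [coxeterMatrix_apply, hij, h, if_true, if_false, pow_succ, pow_zero, one_mul,
          Equiv.Perm.mul_apply, affineReflection_apply,
          affineRoot_sub_smul, hji, h', Equiv.Perm.one_apply]
        module
      · have h' : ¬ (SimpleGraph.cycleGraph 8).Adj j i := fun k => h k.symm
        simp only [coxeterMatrix_apply, hij, h, if_true, if_false, pow_succ, pow_zero, one_mul,
          Equiv.Perm.mul_apply, affineReflection_apply,
          affineRoot_sub_smul, hji, h', Equiv.Perm.one_apply]
        module⟩

/-- The translation subgroup `ℤ⁷` of the affine Coxeter group `ℤ⁷ : S₈` of type `A₇`: the elements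
that act on `ℝ⁸` as translations. -/
def translations : Subgroup (CoxeterGroup (SimpleGraph.cycleGraph 8)) where
  carrier := {w | ∃ v : Fin 8 → ℝ, ∀ x, affineAction w x = x + v}
  one_mem' := ⟨0, fun x => by simp⟩
  mul_mem' := by
    rintro a b ⟨v, hv⟩ ⟨u, hu⟩
    exact ⟨u + v, fun x => by rw [map_mul, Equiv.Perm.mul_apply, hu, hv, add_assoc]⟩
  inv_mem' := by
    rintro a ⟨v, hv⟩
    refine ⟨-v, fun x => ?_⟩
    rw [map_inv, Equiv.Perm.inv_eq_iff_eq, hv]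
    simp

/-- The normal subgroup of the Coxeter group of `Γ` generated by the translations of all free
`8`-gons of `Γ`. A free `8`-gon is an induced subgraph isomorphic to the cycle of length `8`. -/
def deflationSubgroup {V : Type*} (Γ : SimpleGraph V) : Subgroup (CoxeterGroup Γ) :=
  Subgroup.normalClosure
    (⋃ f : SimpleGraph.cycleGraph 8 ↪g Γ, (translations.map (inducedHom f) : Set (CoxeterGroup Γ)))

instance {V : Type*} (Γ : SimpleGraph V) : (deflationSubgroup Γ).Normal :=
  Subgroup.normalClosure_normal

/-- The group obtained from the Coxeter group of `Γ` by deflating all free `8`-gons. -/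
abbrev DeflatedGroup {V : Type*} (Γ : SimpleGraph V) : Type _ :=
  CoxeterGroup Γ ⧸ deflationSubgroup Γ

/-- The incidence graph of points `P` and lines `L`: its nodes are the points and the lines, and a
point is joined to a line exactly when it lies on it. -/
def incidenceGraph (P L : Type*) [Membership P L] : SimpleGraph (P ⊕ L) where
  Adj
    | .inl p, .inr l => p ∈ l
    | .inr l, .inl p => p ∈ l
    | _, _ => False
  symm := ⟨by rintro (p | l) (q | m) h <;> exact h⟩
  loopless := ⟨by rintro (p | l) h <;> exact h⟩

/-- The points of the projective plane of order `2`. Its lines are given by the same type, a point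
lying on a line when their homogeneous coordinates are orthogonal. -/
abbrev FanoPlane : Type := ℙ (ZMod 2) (Fin 3 → ZMod 2)

/-- The `14`-node incidence graph of the projective plane of order `2`. -/
def incP2 : SimpleGraph (FanoPlane ⊕ FanoPlane) := incidenceGraph FanoPlane FanoPlane

/-- The quadratic form `x₀x₁ + x₂x₃ + x₄x₅ + (x₆² + x₆x₇ + x₇²)` on `𝔽₂⁸`, the orthogonal sum of
three hyperbolic planes and the anisotropic plane: the nondegenerate form of minus type. -/
def minusForm : QuadraticForm (ZMod 2) (Fin 8 → ZMod 2) :=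
  QuadraticMap.proj 0 1 + QuadraticMap.proj 2 3 + QuadraticMap.proj 4 5 +
    (QuadraticMap.proj 6 6 + QuadraticMap.proj 6 7 + QuadraticMap.proj 7 7)

/-- The group of all linear isometries of a quadratic form. -/
def isometryGroup {K V : Type*} [CommRing K] [AddCommGroup V] [Module K V]
    (Q : QuadraticForm K V) : Subgroup (V ≃ₗ[K] V) where
  carrier := {g | ∀ x, Q (g x) = Q x}
  one_mem' := fun _ => rfl
  mul_mem' := by
    intro a b ha hb x
    rw [LinearEquiv.mul_apply, ha, hb]
  inv_mem' := by
    intro a ha x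
    rw [← ha (a⁻¹ x), ← LinearEquiv.mul_apply, mul_inv_cancel]
    rfl

/-- The group `O₈⁻(2):2` (in Atlas notation, where `O₈⁻(2)` is the simple group): the full
orthogonal group `GO₈⁻(2)`. -/
abbrev O8Minus2Colon2 : Type := isometryGroup minusForm

end Deflation

end

/-! The adjacency matrix of the incidence graph has rank 8 over 𝔽₂, and the nodes can be represented
by fourteen vectors of 𝔽₂⁸ on which the quadratic form is 1 and whose polar form B is given by
adjacency. Sending a node to the reflection x ↦ x + B(x,u)u in its vector u respects the Coxeter
relations. Along a free octagon the eight vectors add up to zero, so they are the differences of a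
cyclic sequence y₀, …, y₇. The reflections permute these differences as S₈ does, and the image of w
depends only on its permutation (`IsRealization.hom_partialSums`). Hence translations act trivially,
which yields `reflectionHom` on the deflated group.

Injectivity is a coset enumeration in which the vectors of an orbit serve as names of the cosets. If
the cosets of ⟨T⟩ can be attached to the orbit of w₀ under ⟨S⟩ compatibly with all generators, then
the stabilizer of w₀ in ⟨S⟩ lies in ⟨T⟩ (`mem_parabolic_of_complete`). An element of the kernel
fixes every vector, so it descends from the whole group through subgroups generated by nodes of
types E₇, E₆, D₅, A₄, A₃, A₂, A₁ to the trivial group. Octagon relations are used only to reach E₇;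
the other steps need Coxeter relations alone.

For surjectivity, all nonsingular vectors form one orbit, so by conjugation the image contains every
reflection. A Witt type argument along a basis of nonsingular vectors (`exists_mem_range_fixing`)
then writes each isometry as a product of reflections. -/

namespace Deflation

/-! ### Reflections of quadratic spaces over 𝔽₂ -/

section Reflections

variable {V : Type*} [AddCommGroup V] [Module (ZMod 2) V] (Q : QuadraticForm (ZMod 2) V)

theorem zmod_two_add_self (x : V) : x + x = 0 := by
  have : (2 : ZMod 2) • x = 0 := by rw [show (2 : ZMod 2) = 0 from rfl, zero_smul]
  rwa [two_smul] at this

theorem polar_self_eq_zero (u : V) : QuadraticMap.polar Q u u = 0 := by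
  rw [QuadraticMap.polar_self]
  generalize Q u = a
  revert a
  decide

/-- The transvection `x ↦ x + B(x, u) u` attached to a vector `u`. -/
def transvection (u : V) : V →ₗ[ZMod 2] V :=
  LinearMap.id + (Q.polarBilin.flip u).smulRight u

theorem transvection_apply (u x : V) :
    transvection Q u x = x + QuadraticMap.polar Q x u • u := rfl

theorem transvection_involutive (u : V) : Function.Involutive (transvection Q u) := by
  intro x
  rw [transvection_apply, transvection_apply, QuadraticMap.polar_add_left,
    QuadraticMap.polar_smul_left, polar_self_eq_zero, smul_zero, add_zero, add_assoc,
    zmod_two_add_self, add_zero]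

theorem map_transvection {u : V} (hu : Q u = 1) (x : V) : Q (transvection Q u x) = Q x := by
  rw [transvection_apply, QuadraticMap.map_add Q, QuadraticMap.map_smul, hu,
    QuadraticMap.polar_smul_right]
  generalize Q x = a, QuadraticMap.polar Q x u = b
  revert a b
  decide

open Classical in
/-- The reflection in a nonsingular vector `u`, as an isometry; by convention it is the identity
for singular `u`. -/
noncomputable def reflection (u : V) : isometryGroup Q :=
  if hu : Q u = 1 then
    ⟨LinearEquiv.ofInvolutive (transvection Q u) (transvection_involutive Q u),
      map_transvection Q hu⟩
  else 1

variable {Q}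

theorem reflection_apply {u : V} (hu : Q u = 1) (x : V) :
    (reflection Q u : V ≃ₗ[ZMod 2] V) x = x + QuadraticMap.polar Q x u • u := by
  rw [reflection, dif_pos hu]
  rfl

theorem reflection_mul_self (u : V) : reflection Q u * reflection Q u = 1 := by
  by_cases hu : Q u = 1
  · ext x
    have := transvection_involutive Q u x
    rw [transvection_apply, transvection_apply] at this
    simpa [reflection_apply hu] using this
  · rw [reflection, dif_neg hu, one_mul]

theorem reflection_inv (u : V) : (reflection Q u)⁻¹ = reflection Q u :=
  inv_eq_of_mul_eq_one_left (reflection_mul_self u)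

theorem polar_isometry (g : isometryGroup Q) (x y : V) :
    QuadraticMap.polar Q ((g : V ≃ₗ[ZMod 2] V) x) ((g : V ≃ₗ[ZMod 2] V) y) =
      QuadraticMap.polar Q x y := by
  rw [QuadraticMap.polar, ← map_add, g.2, g.2, g.2, QuadraticMap.polar]

theorem conj_reflection (g : isometryGroup Q) (u : V) :
    g * reflection Q u * g⁻¹ = reflection Q ((g : V ≃ₗ[ZMod 2] V) u) := by
  rw [mul_inv_eq_iff_eq_mul]
  by_cases hu : Q u = 1
  · have hgu : Q ((g : V ≃ₗ[ZMod 2] V) u) = 1 := by rw [g.2, hu]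
    ext x
    simp [reflection_apply hu, reflection_apply hgu, polar_isometry]
  · have hgu : ¬ Q ((g : V ≃ₗ[ZMod 2] V) u) = 1 := by rwa [g.2]
    rw [reflection, dif_neg hu, reflection, dif_neg hgu, one_mul, mul_one]

theorem reflection_mul_of_polar_eq_zero {u v : V} (hu : Q u = 1)
    (h : QuadraticMap.polar Q v u = 0) :
    reflection Q u * reflection Q v = reflection Q v * reflection Q u := by
  have := conj_reflection (reflection Q u) v
  rwa [reflection_apply hu, h, zero_smul, add_zero, mul_inv_eq_iff_eq_mul] at this

/-- Both sides are the reflection in u + v: each of the two reflections carries the other vector to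
u + v. -/
theorem reflection_braid {u v : V} (hu : Q u = 1) (hv : Q v = 1)
    (h : QuadraticMap.polar Q v u = 1) :
    reflection Q u * reflection Q v * reflection Q u =
      reflection Q v * reflection Q u * reflection Q v := by
  have h1 := conj_reflection (reflection Q u) v
  have h2 := conj_reflection (reflection Q v) u
  rw [reflection_apply hu, h, one_smul, reflection_inv] at h1
  rw [reflection_apply hv, QuadraticMap.polar_comm, h, one_smul, reflection_inv, add_comm] at h2
  rw [h1, h2]

end Reflections

/-! ### Reflection representations of simply laced Coxeter groups -/

section GraphHom

variable {N : Type*} {Γ : SimpleGraph N} {V : Type*} [AddCommGroup V] [Module (ZMod 2) V]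
  (Q : QuadraticForm (ZMod 2) V) (u : N → V)

open Classical in
/-- Nonsingular vectors whose Gram matrix with respect to the polar form is the adjacency matrix
of a graph. -/
structure IsRealization (Γ : SimpleGraph N) (Q : QuadraticForm (ZMod 2) V) (u : N → V) : Prop where
  map_eq_one : ∀ i, Q (u i) = 1
  polar_eq : ∀ i j, QuadraticMap.polar Q (u i) (u j) = if Γ.Adj i j then 1 else 0

variable {Q u}

theorem IsRealization.isLiftable (h : IsRealization Γ Q u) :
    (coxeterMatrix Γ).IsLiftable fun i => reflection Q (u i) := by
  intro i j
  rw [coxeterMatrix_apply]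
  split_ifs with hij hadj
  · rw [hij, reflection_mul_self, one_pow]
  · have hb := reflection_braid (h.map_eq_one i) (h.map_eq_one j)
      (by rw [h.polar_eq, if_pos hadj.symm])
    calc (reflection Q (u i) * reflection Q (u j)) ^ 3
        = (reflection Q (u i) * reflection Q (u j) * reflection Q (u i)) *
          (reflection Q (u j) * reflection Q (u i) * reflection Q (u j)) := by
          simp only [pow_succ, pow_zero, one_mul, mul_assoc]
      _ = (reflection Q (u j) * reflection Q (u i) * reflection Q (u j)) *
          (reflection Q (u j) * reflection Q (u i) * reflection Q (u j)) := by rw [hb]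
      _ = 1 := by
          have hs (k : N) (a : isometryGroup Q) :
              reflection Q (u k) * (reflection Q (u k) * a) = a := by
            rw [← mul_assoc, reflection_mul_self, one_mul]
          rw [mul_assoc, mul_assoc, mul_assoc, hs, hs, reflection_mul_self]
  · have hc := reflection_mul_of_polar_eq_zero (v := u j) (h.map_eq_one i)
      (by rw [h.polar_eq, if_neg fun k => hadj k.symm])
    rw [pow_two, mul_assoc, ← mul_assoc (reflection Q (u j)), ← hc, mul_assoc,
      reflection_mul_self, mul_one, reflection_mul_self]

/-- The representation of the Coxeter group of a graph by reflections over the field with two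
elements. -/
noncomputable def IsRealization.hom (h : IsRealization Γ Q u) :
    CoxeterGroup Γ →* isometryGroup Q :=
  (coxeterMatrix Γ).toCoxeterSystem.lift ⟨fun i => reflection Q (u i), h.isLiftable⟩

theorem IsRealization.hom_simple (h : IsRealization Γ Q u) (i : N) :
    h.hom ((coxeterMatrix Γ).simple i) = reflection Q (u i) :=
  (coxeterMatrix Γ).toCoxeterSystem.lift_apply_simple h.isLiftable i

theorem inducedHom_simple {W : Type*} {Δ : SimpleGraph W} (f : Γ ↪g Δ) (i : N) :
    inducedHom f ((coxeterMatrix Γ).simple i) = (coxeterMatrix Δ).simple (f i) :=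
  (coxeterMatrix Γ).toCoxeterSystem.lift_apply_simple _ i

end GraphHom

/-! ### Translations as the kernel of the map from the affine group to S₈ -/

section Affine

/-- The linear part of the affine Coxeter group of type `A₇`: the permutation of coordinates. -/
noncomputable def permHom : CoxeterGroup (SimpleGraph.cycleGraph 8) →* Equiv.Perm (Fin 8) :=
  (coxeterMatrix (SimpleGraph.cycleGraph 8)).toCoxeterSystem.lift
    ⟨fun i => Equiv.swap i (i + 1), by
      intro i j
      simp only [coxeterMatrix_apply]
      have h : ∀ i j : Fin 8, (Equiv.swap i (i + 1) * Equiv.swap j (j + 1)) ^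
          (if i = j then 1 else if (SimpleGraph.cycleGraph 8).Adj i j then 3 else 2) = 1 := by
        decide
      convert h i j⟩

theorem permHom_simple (i : Fin 8) :
    permHom ((coxeterMatrix (SimpleGraph.cycleGraph 8)).simple i) = Equiv.swap i (i + 1) :=
  (coxeterMatrix (SimpleGraph.cycleGraph 8)).toCoxeterSystem.lift_apply_simple _ i

theorem affineAction_simple (i : Fin 8) :
    affineAction ((coxeterMatrix (SimpleGraph.cycleGraph 8)).simple i) = affineReflection i :=
  (coxeterMatrix (SimpleGraph.cycleGraph 8)).toCoxeterSystem.lift_apply_simple _ i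

theorem affineReflection_eq (j : Fin 8) :
    ∃ c : Fin 8 → ℝ, ∀ x k, affineReflection j x k = x (Equiv.swap j (j + 1) k) + c k := by
  refine ⟨affineReflection j 0, fun x k => ?_⟩
  have hj : j + 1 ≠ j := by revert j; decide
  simp only [affineReflection_apply, affineRoot, rootVector, Pi.sub_apply, Pi.smul_apply,
    Pi.single_apply, smul_eq_mul, Pi.zero_apply]
  by_cases h1 : k = j
  · subst h1
    simp [hj.symm]
    ring
  · by_cases h2 : k = j + 1
    · subst h2
      simp [hj]
      ring
    · simp [h1, h2, Equiv.swap_apply_of_ne_of_ne]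

theorem exists_affineAction_eq (w : CoxeterGroup (SimpleGraph.cycleGraph 8)) :
    ∃ c : Fin 8 → ℝ, ∀ x k, affineAction w x k = x ((permHom w)⁻¹ k) + c k := by
  induction w using (coxeterMatrix (SimpleGraph.cycleGraph 8)).toCoxeterSystem.simple_induction_left
    with
  | one => exact ⟨0, fun x k => by simp⟩
  | mul_simple_left w i ih =>
    obtain ⟨c, hc⟩ := ih
    obtain ⟨d, hd⟩ := affineReflection_eq i
    refine ⟨fun k => c (Equiv.swap i (i + 1) k) + d k, fun x k => ?_⟩
    change affineAction ((coxeterMatrix (SimpleGraph.cycleGraph 8)).simple i * w) x k =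
      x ((permHom ((coxeterMatrix (SimpleGraph.cycleGraph 8)).simple i * w))⁻¹ k) + _
    rw [map_mul, map_mul, affineAction_simple, permHom_simple, Equiv.Perm.mul_apply, hd, hc,
      mul_inv_rev, Equiv.swap_inv, Equiv.Perm.mul_apply, add_assoc]

/-- An element acts by permuting coordinates through `permHom` and then adding a constant, so it is
a translation exactly when its permutation is trivial. This replaces real affine geometry by S₈ in
all that follows. -/
theorem mem_translations_iff (w : CoxeterGroup (SimpleGraph.cycleGraph 8)) :
    w ∈ translations ↔ permHom w = 1 := by
  obtain ⟨c, hc⟩ := exists_affineAction_eq w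
  constructor
  · rintro ⟨v, hv⟩
    have hcv : ∀ k, c k = v k := fun k => by
      have := hc 0 k
      rw [hv] at this
      simpa using this.symm
    rw [← inv_eq_one]
    ext1 k
    -- The k-th coordinate of the image of the k-th unit vector shows whether the permutation fixes
    -- k.
    have := hc (Pi.single k 1) k
    rw [hv, Pi.add_apply, hcv, Pi.single_eq_same, add_left_inj, Pi.single_apply] at this
    by_contra hne
    rw [if_neg fun h => hne (by simpa using h)] at this
    exact one_ne_zero this
  · intro h
    refine ⟨c, fun x => funext fun k => ?_⟩
    rw [hc, h]
    rfl

end Affine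

/-! ### Octagons with vanishing sum act through S₈ -/

section Octagon

variable {V : Type*} [AddCommGroup V] [Module (ZMod 2) V]
  {Q : QuadraticForm (ZMod 2) V} {u : Fin 8 → V}

/-- The partial sums of eight vectors: when the vectors add up to zero, consecutive partial sums
differ by them also cyclically. -/
theorem exists_partialSums (hsum : ∑ i, u i = 0) :
    ∃ y : Fin 8 → V, ∀ i, y i + y (i + 1) = u i := by
  refine ⟨fun k => ∑ i with i < k, u i, fun i => ?_⟩
  have key (a b : V) : a + (a + b) = b := by rw [← add_assoc, zmod_two_add_self, zero_add]
  beta_reduce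
  -- In `Fin 8` the successor of 7 is 0, whose partial sum is empty. The closing difference is
  -- therefore u₀ + … + u₆, which equals u₇ because the total vanishes.
  by_cases hi : i = 7
  · subst hi
    have h0 : (Finset.univ.filter fun i : Fin 8 => i < 7 + 1) = ∅ := by decide
    have h7 : (Finset.univ : Finset (Fin 8)) = insert 7 (Finset.univ.filter (· < 7)) := by decide
    rw [h7, Finset.sum_insert (by decide)] at hsum
    rw [h0, Finset.sum_empty, add_zero, eq_comm, ← sub_eq_zero, sub_eq_add_neg,
      neg_eq_of_add_eq_zero_left (zmod_two_add_self _), hsum]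
  · have h : ∀ i : Fin 8, i ≠ 7 → (Finset.univ.filter (· < i + 1)) =
        insert i (Finset.univ.filter (· < i)) := by decide
    rw [h i hi, Finset.sum_insert (by simp), add_comm (u i), key]

/-- The y's play the role of coordinate vectors, with u j as the root joining y j and y (j + 1).
Only sums of two of them are permuted, since the y's are determined only up to a common summand. -/
theorem IsRealization.reflection_partialSums
    (h : IsRealization (SimpleGraph.cycleGraph 8) Q u) {y : Fin 8 → V}
    (hy : ∀ i, y i + y (i + 1) = u i) (j a b : Fin 8) :
    (reflection Q (u j) : V ≃ₗ[ZMod 2] V) (y a + y b) =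
      y (Equiv.swap j (j + 1) a) + y (Equiv.swap j (j + 1) b) := by
  have key (a b c : V) : (a + b) + (b + c) = a + c := by
    rw [add_assoc, ← add_assoc b, zmod_two_add_self, zero_add]
  have hu (i : Fin 8) : (reflection Q (u j) : V ≃ₗ[ZMod 2] V) (y i + y (i + 1)) =
      y (Equiv.swap j (j + 1) i) + y (Equiv.swap j (j + 1) (i + 1)) := by
    rw [hy, reflection_apply (h.map_eq_one j), h.polar_eq]
    by_cases hij : i = j
    · subst hij
      simp [add_comm (y (i + 1)), hy]
    · by_cases h1 : i = j + 1
      · subst h1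
        have hne : ∀ j : Fin 8, j + 1 + 1 ≠ j ∧ j + 1 + 1 ≠ j + 1 ∧
          (SimpleGraph.cycleGraph 8).Adj (j + 1) j := by decide
        rw [if_pos (hne j).2.2, one_smul, Equiv.swap_apply_right,
          Equiv.swap_apply_of_ne_of_ne (hne j).1 (hne j).2.1, ← hy, ← hy, add_comm, key]
      · by_cases h2 : i + 1 = j
        · subst h2
          have hne : ∀ i : Fin 8, i ≠ i + 1 ∧ i ≠ i + 1 + 1 ∧
            (SimpleGraph.cycleGraph 8).Adj i (i + 1) := by decide
          rw [if_pos (hne i).2.2, one_smul, Equiv.swap_apply_left,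
            Equiv.swap_apply_of_ne_of_ne (hne i).1 (hne i).2.1, ← hy, ← hy, key]
        · have hne : ∀ i j : Fin 8, i ≠ j → i ≠ j + 1 → i + 1 ≠ j →
            i + 1 ≠ j + 1 ∧ ¬ (SimpleGraph.cycleGraph 8).Adj i j := by decide
          obtain ⟨h3, h4⟩ := hne i j hij h1 h2
          rw [if_neg h4, zero_smul, add_zero, Equiv.swap_apply_of_ne_of_ne hij h1,
            Equiv.swap_apply_of_ne_of_ne h2 h3, hy]
  -- The sum y₀ + yₐ telescopes into consecutive differences, for which the claim is `hu`.
  have h0 (a : Fin 8) : (reflection Q (u j) : V ≃ₗ[ZMod 2] V) (y 0 + y a) =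
      y (Equiv.swap j (j + 1) 0) + y (Equiv.swap j (j + 1) a) := by
    induction a using Fin.induction with
    | zero => rw [zmod_two_add_self, zmod_two_add_self, map_zero]
    | succ i ih =>
      have hi := hu i.castSucc
      rw [Fin.coeSucc_eq_succ] at hi
      rw [← key (y 0) (y i.castSucc), map_add, ih, hi, key]
  rw [← key (y a) (y 0), map_add, add_comm (y a), h0, h0, add_comm (y (Equiv.swap j (j + 1) 0)),
    key]

/-- The point of the second formula is that w enters only through `permHom w`. The first formula is
what carries the induction. -/
theorem IsRealization.hom_partialSums
    (h : IsRealization (SimpleGraph.cycleGraph 8) Q u) {y : Fin 8 → V}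
    (hy : ∀ i, y i + y (i + 1) = u i) (w : CoxeterGroup (SimpleGraph.cycleGraph 8)) :
    (∀ a b, (h.hom w : V ≃ₗ[ZMod 2] V) (y a + y b) = y (permHom w a) + y (permHom w b)) ∧
    ∀ x, (h.hom w : V ≃ₗ[ZMod 2] V) x =
      x + ∑ k, QuadraticMap.polar Q x (y k) • (y k + y (permHom w k)) := by
  induction w using
    (coxeterMatrix (SimpleGraph.cycleGraph 8)).toCoxeterSystem.simple_induction_right with
  | one =>
    refine ⟨fun a b => by simp, fun x => ?_⟩
    simp [zmod_two_add_self]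
  | mul_simple_right w j ih =>
    obtain ⟨ih₁, ih₂⟩ := ih
    change (∀ a b, (h.hom (w * (coxeterMatrix (SimpleGraph.cycleGraph 8)).simple j) :
        V ≃ₗ[ZMod 2] V) (y a + y b) =
        y (permHom (w * (coxeterMatrix (SimpleGraph.cycleGraph 8)).simple j) a) +
        y (permHom (w * (coxeterMatrix (SimpleGraph.cycleGraph 8)).simple j) b)) ∧
      ∀ x, (h.hom (w * (coxeterMatrix (SimpleGraph.cycleGraph 8)).simple j) : V ≃ₗ[ZMod 2] V) x =
        x + ∑ k, QuadraticMap.polar Q x (y k) •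
          (y k + y (permHom (w * (coxeterMatrix (SimpleGraph.cycleGraph 8)).simple j) k))
    rw [map_mul, map_mul, h.hom_simple, permHom_simple]
    refine ⟨fun a b => ?_, fun x => ?_⟩
    · rw [Subgroup.coe_mul, LinearEquiv.mul_apply, h.reflection_partialSums hy, ih₁]
      rfl
    · have hj : j ≠ j + 1 := by revert j; decide
      rw [Subgroup.coe_mul, LinearEquiv.mul_apply, reflection_apply (h.map_eq_one j), map_add,
        map_smul, ih₂, ← hy, ih₁, add_assoc]
      congr 1
      set p : Fin 8 → ZMod 2 := fun k => QuadraticMap.polar Q x (y k)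
      -- Passing from w to its product with the j-th generator changes only the terms with k = j and
      -- k = j + 1, and these combine to the image of the added root.
      have hsum : ∑ k, p k • (y (permHom w k) + y ((permHom w * Equiv.swap j (j + 1)) k)) =
          QuadraticMap.polar Q x (y j + y (j + 1)) •
            (y (permHom w j) + y (permHom w (j + 1))) := by
        rw [Finset.sum_eq_add j (j + 1) hj]
        · simp only [Equiv.Perm.mul_apply, Equiv.swap_apply_left, Equiv.swap_apply_right]
          rw [QuadraticMap.polar_add_right, add_smul, add_comm (y (permHom w (j + 1)))]
        · rintro k - ⟨h1, h2⟩
          rw [Equiv.Perm.mul_apply, Equiv.swap_apply_of_ne_of_ne h1 h2, zmod_two_add_self,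
            smul_zero]
        · simp
        · simp
      rw [← hsum, ← Finset.sum_add_distrib]
      refine Finset.sum_congr rfl fun k _ => ?_
      rw [← smul_add, add_assoc, ← add_assoc (y (permHom w k)), zmod_two_add_self, zero_add]

theorem IsRealization.hom_eq_one_of_mem_translations
    (h : IsRealization (SimpleGraph.cycleGraph 8) Q u) (hsum : ∑ i, u i = 0)
    {w : CoxeterGroup (SimpleGraph.cycleGraph 8)} (hw : w ∈ translations) : h.hom w = 1 := by
  obtain ⟨y, hy⟩ := exists_partialSums hsum
  ext x
  rw [(h.hom_partialSums hy w).2, (mem_translations_iff w).1 hw]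
  simp [zmod_two_add_self]

variable {N : Type*} {Γ : SimpleGraph N} {v : N → V}

theorem IsRealization.comp {M : Type*} {Δ : SimpleGraph M} (h : IsRealization Γ Q v) (f : Δ ↪g Γ) :
    IsRealization Δ Q (v ∘ f) where
  map_eq_one i := h.map_eq_one _
  polar_eq i j := by
    rw [Function.comp_apply, Function.comp_apply, h.polar_eq]
    classical exact if_congr f.map_adj_iff rfl rfl

theorem IsRealization.hom_inducedHom {M : Type*} {Δ : SimpleGraph M} (h : IsRealization Γ Q v)
    (f : Δ ↪g Γ) : h.hom.comp (inducedHom f) = (h.comp f).hom := by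
  refine (coxeterMatrix Δ).toCoxeterSystem.ext_simple fun i => ?_
  exact (congrArg h.hom (inducedHom_simple f i)).trans
    ((h.hom_simple _).trans ((h.comp f).hom_simple i).symm)

theorem IsRealization.deflationSubgroup_le_ker (h : IsRealization Γ Q v)
    (hsum : ∀ f : SimpleGraph.cycleGraph 8 ↪g Γ, ∑ i, v (f i) = 0) :
    deflationSubgroup Γ ≤ h.hom.ker := by
  refine Subgroup.normalClosure_le_normal ?_
  rintro _ ⟨_, ⟨f, rfl⟩, w, hw, rfl⟩
  change h.hom.comp (inducedHom f) w = 1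
  rw [h.hom_inducedHom]
  exact (h.comp f).hom_eq_one_of_mem_translations (hsum f) hw

/-- The representation of the deflated group by reflections. -/
noncomputable def IsRealization.deflatedHom (h : IsRealization Γ Q v)
    (hsum : ∀ f : SimpleGraph.cycleGraph 8 ↪g Γ, ∑ i, v (f i) = 0) :
    DeflatedGroup Γ →* isometryGroup Q :=
  QuotientGroup.lift _ h.hom (h.deflationSubgroup_le_ker hsum)

/-- The image in the deflated group of the product of simple generators along the walk that goes
along a free octagon up to its last but one node and back, and closes up with the last node, is
trivial. -/
theorem prod_octagon_eq_one (f : SimpleGraph.cycleGraph 8 ↪g Γ) :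
    (([0, 1, 2, 3, 4, 5, 6, 5, 4, 3, 2, 1, 0, 7] : List (Fin 8)).map fun i =>
      ((coxeterMatrix Γ).simple (f i) : DeflatedGroup Γ)).prod = 1 := by
  set l : List (Fin 8) := [0, 1, 2, 3, 4, 5, 6, 5, 4, 3, 2, 1, 0, 7] with hl
  set w := (l.map (coxeterMatrix (SimpleGraph.cycleGraph 8)).simple).prod with hw
  -- The palindrome 0 1 … 6 … 1 0 maps to the transposition of 0 and 7, which is also the image of
  -- the generator 7.
  have h1 : permHom w = 1 := by
    have hp : permHom ∘ (coxeterMatrix (SimpleGraph.cycleGraph 8)).simple =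
        fun i => Equiv.swap i (i + 1) := funext permHom_simple
    rw [hw, map_list_prod, List.map_map, hp, hl]
    decide
  have h2 : ((inducedHom f w : CoxeterGroup Γ) : DeflatedGroup Γ) = 1 :=
    (QuotientGroup.eq_one_iff _).2 <| Subgroup.subset_normalClosure <|
      Set.mem_iUnion.2 ⟨f, w, (mem_translations_iff w).2 h1, rfl⟩
  rw [← h2, ← QuotientGroup.mk'_apply, hw, map_list_prod, map_list_prod, List.map_map,
    List.map_map]
  congr 1

end Octagon

/-! ### Vectors coded by numbers below 256 -/

/-- The vector of `𝔽₂⁸` whose coordinates are the binary digits of a number. -/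
def decode (w : ℕ) (i : Fin 8) : ZMod 2 := if w.testBit i then 1 else 0

/-- The table of values of the quadratic form at the vectors coded by the numbers below `256`. -/
def quad (w : ℕ) : Bool :=
  Nat.testBit 0x7888877787778777788887778777877778888777877787778777788878887888 w

/-- The codes of fourteen nonsingular vectors attached to the points and lines. -/
def vec (s : ℕ) : ℕ := (0x777e5f56a0a98844505440130703 >>> (8 * s)) % 256

/-- The action on codes of the reflection in the vector coded by `vec s`. -/
def act (s w : ℕ) : ℕ := bif quad (w ^^^ vec s) == quad w then w ^^^ vec s else w

/-- Adjacency of the nodes numbered `s` and `t`. -/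
def adj (s t : ℕ) : Bool := quad (vec s ^^^ vec t)

theorem minusForm_apply (x : Fin 8 → ZMod 2) : minusForm x =
    x 0 * x 1 + x 2 * x 3 + x 4 * x 5 + (x 6 * x 6 + x 6 * x 7 + x 7 * x 7) := rfl

theorem minusForm_decode {w : ℕ} (hw : w < 256) :
    minusForm (decode w) = if quad w then 1 else 0 := by
  rw [minusForm_apply]
  revert w
  decide +kernel

theorem decode_xor (a b : ℕ) : decode (a ^^^ b) = decode a + decode b := by
  funext i
  simp only [decode, Pi.add_apply, Nat.testBit_xor]
  cases a.testBit i <;> cases b.testBit i <;> decide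

theorem decode_injOn {a b : ℕ} (ha : a < 256) (hb : b < 256) (h : decode a = decode b) : a = b := by
  refine Nat.eq_of_testBit_eq fun i => ?_
  by_cases hi : i < 8
  · have := congrFun h ⟨i, hi⟩
    simp only [decode] at this
    cases h1 : a.testBit i <;> cases h2 : b.testBit i <;> simp_all
  · have h256 : 256 ≤ 2 ^ i := (Nat.pow_le_pow_right two_pos (not_lt.1 hi) : 2 ^ 8 ≤ 2 ^ i)
    rw [Nat.testBit_lt_two_pow (ha.trans_le h256), Nat.testBit_lt_two_pow (hb.trans_le h256)]

theorem exists_decode_eq (x : Fin 8 → ZMod 2) : ∃ w < 256, decode w = x := by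
  have hinj : Function.Injective fun w : Fin 256 => decode w :=
    fun a b h => Fin.ext (decode_injOn a.2 b.2 h)
  obtain ⟨w, hw⟩ := ((Fintype.bijective_iff_injective_and_card _).2 ⟨hinj, by simp⟩).2 x
  exact ⟨w, w.2, hw⟩

theorem xor_lt {a b : ℕ} (ha : a < 256) (hb : b < 256) : a ^^^ b < 256 :=
  Nat.xor_lt_two_pow (n := 8) ha hb

theorem vec_lt (s : ℕ) : vec s < 256 := Nat.mod_lt _ (by norm_num)

theorem quad_vec {s : ℕ} (hs : s < 14) : quad (vec s) = true := by
  revert s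
  decide

theorem minusForm_vec {s : ℕ} (hs : s < 14) : minusForm (decode (vec s)) = 1 := by
  rw [minusForm_decode (vec_lt s), quad_vec hs, if_pos rfl]

theorem polar_decode {a b : ℕ} (ha : a < 256) (hb : b < 256) :
    QuadraticMap.polar minusForm (decode a) (decode b) =
      if (quad (a ^^^ b) ^^ quad a ^^ quad b) then 1 else 0 := by
  rw [QuadraticMap.polar, ← decode_xor, minusForm_decode (xor_lt ha hb), minusForm_decode ha,
    minusForm_decode hb]
  cases quad (a ^^^ b) <;> cases quad a <;> cases quad b <;> decide

theorem act_lt {s w : ℕ} (hw : w < 256) : act s w < 256 := by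
  rw [act]
  cases quad (w ^^^ vec s) == quad w
  · exact hw
  · exact xor_lt hw (vec_lt s)

theorem act_act (s w : ℕ) : act s (act s w) = w := by
  rw [act, act]
  cases h : quad (w ^^^ vec s) == quad w
  · simp [h]
  · have : quad w == quad (w ^^^ vec s) := by rwa [Bool.beq_comm]
    simp [this]

/-- For q(v) = 1 one has q(w + v) = q(w) + 1 + B(w,v). So the test in `act`, whether q(w + v) =
q(w), decides whether B(w,v) = 1. -/
theorem reflection_decode {s w : ℕ} (hs : s < 14) (hw : w < 256) :
    (reflection minusForm (decode (vec s)) : (Fin 8 → ZMod 2) ≃ₗ[ZMod 2] (Fin 8 → ZMod 2))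
      (decode w) = decode (act s w) := by
  rw [reflection_apply (minusForm_vec hs), polar_decode hw (vec_lt s), quad_vec hs, act]
  cases quad (w ^^^ vec s) <;> cases quad w <;> simp [decode_xor]

/-! ### Numbering the nodes of the incidence graph -/

/-- The vector of binary digits of a number, in `𝔽₂³`. -/
def bits (n : ℕ) (i : Fin 3) : ZMod 2 := if n.testBit i then 1 else 0

theorem bits_ne_zero (i : ℕ) : bits (i % 7 + 1) ≠ 0 := by
  have h : ∀ j < 7, bits (j + 1) ≠ 0 := by decide
  exact h _ (Nat.mod_lt _ (by norm_num))

/-- The points of the Fano plane, numbered modulo `7`. -/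
noncomputable def point (i : ℕ) : FanoPlane := .mk _ (bits (i % 7 + 1)) (bits_ne_zero i)

/-- The nodes of the incidence graph of the Fano plane: the points have the numbers `0` to `6`
and the lines the numbers `7` to `13`. -/
noncomputable def node (s : ℕ) : FanoPlane ⊕ FanoPlane :=
  if s < 7 then .inl (point s) else .inr (point s)

theorem exists_point_eq (p : FanoPlane) : ∃ i < 7, point i = p := by
  induction p using Projectivization.ind with | h x hx =>
  have h : ∀ x : Fin 3 → ZMod 2, x ≠ 0 → ∃ i < 7, bits (i % 7 + 1) = x := by decide
  obtain ⟨i, hi, rfl⟩ := h x hx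
  exact ⟨i, hi, rfl⟩

theorem point_injOn {i j : ℕ} (h : point i = point j) : i % 7 = j % 7 := by
  obtain ⟨a, ha⟩ := (Projectivization.mk_eq_mk_iff' _ _ _ _ _).1 h
  have key : ∀ i < 7, ∀ j < 7, ∀ a : ZMod 2, a • bits (j + 1) = bits (i + 1) → i = j := by decide
  exact key _ (Nat.mod_lt _ (by norm_num)) _ (Nat.mod_lt _ (by norm_num)) a ha

theorem point_add_seven (i : ℕ) : point (i + 7) = point i := by
  simp [point]

theorem exists_node_eq (n : FanoPlane ⊕ FanoPlane) : ∃ s < 14, node s = n := by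
  rcases n with p | p <;> obtain ⟨i, hi, rfl⟩ := exists_point_eq p
  · exact ⟨i, by omega, if_pos hi⟩
  · exact ⟨i + 7, by omega, by rw [node, if_neg (by omega), point_add_seven]⟩

theorem node_injOn {s t : ℕ} (hs : s < 14) (ht : t < 14) (h : node s = node t) : s = t := by
  rw [node, node] at h
  split_ifs at h with h1 h2 h2
  · have := point_injOn (Sum.inl_injective h)
    omega
  · have := point_injOn (Sum.inr_injective h)
    omega

/-- This ties the table `vec` to the plane: the Gram matrix of the coded vectors agrees with
orthogonality of homogeneous coordinates. -/
theorem incP2_adj_node {s t : ℕ} (hs : s < 14) (ht : t < 14) :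
    incP2.Adj (node s) (node t) ↔ adj s t = true := by
  have hmem (i j : ℕ) : point i ∈ point j ↔ bits (i % 7 + 1) ⬝ᵥ bits (j % 7 + 1) = 0 :=
    Projectivization.orthogonal_mk _ _
  rw [node, node]
  split_ifs with h1 h2 h2
  · have key : ∀ s < 7, ∀ t < 7, adj s t = false := by decide
    rw [key s h1 t h2]
    exact iff_of_false id (by simp)
  · refine (hmem s t).trans ?_
    have key : ∀ s < 7, ∀ t < 14, 7 ≤ t →
      (bits (s % 7 + 1) ⬝ᵥ bits (t % 7 + 1) = 0 ↔ adj s t = true) := by decide +kernel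
    exact key s h1 t ht (not_lt.1 h2)
  · refine (hmem t s).trans ?_
    have key : ∀ t < 7, ∀ s < 14, 7 ≤ s →
      (bits (t % 7 + 1) ⬝ᵥ bits (s % 7 + 1) = 0 ↔ adj s t = true) := by decide +kernel
    exact key t h2 s hs (not_lt.1 h1)
  · have key : ∀ s < 14, 7 ≤ s → ∀ t < 14, 7 ≤ t → adj s t = false := by decide
    rw [key s hs (not_lt.1 h1) t ht (not_lt.1 h2)]
    exact iff_of_false id (by simp)

/-- The number of a node. -/
noncomputable def index (n : FanoPlane ⊕ FanoPlane) : ℕ := (exists_node_eq n).choose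

theorem index_lt (n : FanoPlane ⊕ FanoPlane) : index n < 14 := (exists_node_eq n).choose_spec.1

theorem node_index (n : FanoPlane ⊕ FanoPlane) : node (index n) = n :=
  (exists_node_eq n).choose_spec.2

theorem index_node {s : ℕ} (hs : s < 14) : index (node s) = s :=
  node_injOn (index_lt _) hs (node_index _)

theorem isRealization_incP2 : IsRealization incP2 minusForm fun n => decode (vec (index n)) where
  map_eq_one n := minusForm_vec (index_lt n)
  polar_eq m n := by
    rw [polar_decode (vec_lt _) (vec_lt _), quad_vec (index_lt m), quad_vec (index_lt n)]
    have h := incP2_adj_node (index_lt m) (index_lt n)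
    rw [node_index, node_index] at h
    classical
    refine if_congr (Iff.trans ?_ h.symm) rfl rfl
    simp [adj]

/-! ### Octagon sums vanish -/

/-- Whether all extensions by `n` further nodes of a path with reversed list of nodes `a :: l` and
sum `c` to a cycle through the node `z` have vanishing sum. -/
def cycleSumsVanish (z : ℕ) : ℕ → ℕ → List ℕ → ℕ → Bool
  | 0, a, _, c => !adj a z || c == 0
  | n + 1, a, l, c => (List.range 14).all fun d =>
      !adj a d || l.any (· == d) || cycleSumsVanish z n d (a :: l) (c ^^^ vec d)

theorem cycleSumsVanish_start : ∀ z < 14, cycleSumsVanish z 7 z [] (vec z) = true := by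
  decide +kernel

theorem cycleSumsVanish_step {z n a c d : ℕ} {l : List ℕ}
    (h : cycleSumsVanish z (n + 1) a l c = true)
    (hd : d < 14) (had : adj a d = true) (hdl : ∀ b ∈ l, b ≠ d) :
    cycleSumsVanish z n d (a :: l) (c ^^^ vec d) = true := by
  rw [cycleSumsVanish, List.all_eq_true] at h
  have h' := h d (List.mem_range.2 hd)
  have hl : l.any (· == d) = false := by
    rw [List.any_eq_false]
    intro b hb
    simpa using hdl b hb
  simpa [had, hl] using h'

/-- Conceptually, the four points of an octagon form a quadrangle, which every line meets in an even
number of points, and dually; so the sum is orthogonal to all fourteen vectors, which span. The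
verification is a search over all closed walks through eight distinct nodes, without using that the
octagon has no chords. -/
theorem sum_octagon_eq_zero (f : SimpleGraph.cycleGraph 8 ↪g incP2) :
    ∑ i, decode (vec (index (f i))) = 0 := by
  set a : Fin 8 → ℕ := fun i => index (f i)
  have hadj (i : Fin 8) : adj (a i) (a (i + 1)) = true := by
    rw [← incP2_adj_node (index_lt _) (index_lt _), node_index, node_index, f.map_adj_iff]
    revert i
    decide
  have hne {i j : Fin 8} (hij : i ≠ j) : a i ≠ a j := fun h => hij <| f.injective <| by
    rw [← node_index (f i), ← node_index (f j)]
    exact congrArg node h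
  have hlt (i : Fin 8) : a i < 14 := index_lt _
  have h0 := cycleSumsVanish_start (a 0) (hlt 0)
  have h1 := cycleSumsVanish_step h0 (hlt 1) (hadj 0) (by simp)
  have h2 := cycleSumsVanish_step h1 (hlt 2) (hadj 1) (by simp [hne])
  have h3 := cycleSumsVanish_step h2 (hlt 3) (hadj 2) (by simp [hne])
  have h4 := cycleSumsVanish_step h3 (hlt 4) (hadj 3) (by simp [hne])
  have h5 := cycleSumsVanish_step h4 (hlt 5) (hadj 4) (by simp [hne])
  have h6 := cycleSumsVanish_step h5 (hlt 6) (hadj 5) (by simp [hne])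
  have h7 := cycleSumsVanish_step h6 (hlt 7) (hadj 6) (by simp [hne])
  rw [cycleSumsVanish, show adj (a 7) (a 0) = true from hadj 7] at h7
  simp only [Bool.not_true, Bool.false_or, beq_iff_eq] at h7
  have h8 := congrArg decode h7
  simp only [decode_xor] at h8
  rw [Fin.sum_univ_eight]
  refine h8.trans ?_
  funext i
  simp [decode]

/-- The group obtained by deflating all free octagons. -/
abbrev FanoDeflation : Type := DeflatedGroup incP2

/-- The representation of the deflated group on `𝔽₂⁸` by reflections. -/
noncomputable def reflectionHom : FanoDeflation →* isometryGroup minusForm :=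
  isRealization_incP2.deflatedHom sum_octagon_eq_zero

/-- The image of a node in the deflated group. -/
noncomputable def gen (s : ℕ) : FanoDeflation := ((coxeterMatrix incP2).simple (node s) : _)

theorem reflectionHom_gen {s : ℕ} (hs : s < 14) :
    reflectionHom (gen s) = reflection minusForm (decode (vec s)) := by
  refine (isRealization_incP2.hom_simple (node s)).trans ?_
  rw [index_node hs]

theorem reflectionHom_gen_decode {s w : ℕ} (hs : s < 14) (hw : w < 256) :
    (reflectionHom (gen s) : (Fin 8 → ZMod 2) ≃ₗ[ZMod 2] (Fin 8 → ZMod 2)) (decode w) =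
      decode (act s w) := by
  rw [reflectionHom_gen hs, reflection_decode hs hw]

/-! ### Coset enumeration

A state of the enumeration is a number `K`, read as a set of binary digits. The digit `16 * w + s`
with `s < 14` records that the action of the generator `s` on the coset attached to the code `w`
is known to lead to the coset attached to `act s w`; the digit `16 * w + 15` records that a coset
has been attached to `w`. -/

/-- Whether the digit `16 * w + s` of a state is set. -/
def known (K w s : ℕ) : Bool := K.testBit (16 * w + s)

/-- Record the edge from `w` to `act s w` and its reverse. -/
def insertEdge (K w s : ℕ) : ℕ :=
  K ||| (1 <<< (16 * w + s) ||| 1 <<< (16 * act s w + s))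

/-- A left fold that evaluates the accumulator at each step. -/
def strictFold {α : Type*} (f : ℕ → α → ℕ) : List α → ℕ → ℕ
  | [], K => K
  | a :: l, K => match f K a with
    | 0 => strictFold f l 0
    | n + 1 => strictFold f l (n + 1)

/-- Apply `f` for all codes to which a coset is attached. -/
def sweep (f : ℕ → ℕ → ℕ) (K : ℕ) : ℕ :=
  strictFold (fun K w => bif known K w 15 then f K w else K) (List.range 256) K

/-- Attach a coset to `act s w` if there is none yet. -/
def grow (K w s : ℕ) : ℕ :=
  bif known K w 15 && !known K (act s w) 15 then
    insertEdge (K ||| 1 <<< (16 * act s w + 15)) w s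
  else K

/-- Whether the walk along `l` from `w` uses known edges only and ends at `u`. -/
def follows (K : ℕ) : ℕ → List ℕ → ℕ → Bool
  | w, [], u => w == u
  -- The match forces `act t w` to be reduced to a numeral before the walk continues.
  | w, t :: l, u => bif known K w t then (match act t w with
    | 0 => follows K 0 l u
    | n + 1 => follows K (n + 1) l u) else false

/-- A word in `s` and `t` that represents `s`, by the Coxeter relations. -/
def coxeterWord (s t : ℕ) : List ℕ := bif adj s t then [t, s, t, s, t] else [t, s, t]

/-- Record the edge from `w` to `act s w` if it follows from a Coxeter relation with one of the
generators in `T`. -/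
def deduce (T : List ℕ) (K w s : ℕ) : ℕ :=
  bif known K w s then K
  else bif T.any fun t => follows K w (coxeterWord s t) (act s w) then insertEdge K w s
  else K

/-- Record what follows from the Coxeter relations for the edges at `w`. -/
def deduceRow (S : List ℕ) (K w : ℕ) : ℕ :=
  -- If t fixes w, the second letter of the word for s would traverse the very edge to be deduced;
  -- such t are useless and are left out.
  strictFold (fun K' s => deduce (S.filter fun t => !(act t w == w)) K' w s) S K

/-- The relator of an octagon, rotated by `j` steps. -/
def octagonWord (o : Fin 8 → ℕ) (j : ℕ) : List ℕ :=
  (([0, 1, 2, 3, 4, 5, 6, 5, 4, 3, 2, 1, 0, 7] : List (Fin 8)).map o).rotate j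

/-- A point at which the rotated relator of an octagon is to be used. -/
structure OctagonStep where
  code : ℕ
  octagon : Fin 8 → ℕ
  rotation : ℕ

/-- Record the first edge of the relator of an octagon if its other edges are known. -/
def deduceOctagon (K : ℕ) (p : OctagonStep) : ℕ :=
  match octagonWord p.octagon p.rotation with
  | [] => K
  | s :: l => bif follows K p.code l (act s p.code) then insertEdge K p.code s else K

/-- The initial state, in which the generators in `S` fix the coset attached to `w`. -/
def start (S : List ℕ) (w : ℕ) : ℕ :=
  strictFold (fun K s => K ||| 1 <<< (16 * w + s)) S (1 <<< (16 * w + 15))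

/-- Attach cosets to the codes that can be reached, in `n` sweeps. -/
def explore (S : List ℕ) (n : ℕ) (K : ℕ) : ℕ :=
  strictFold (fun K _ => sweep (fun K w => strictFold (fun K s => grow K w s) S K) K)
    (List.range n) K

/-- Alternate between deductions from octagon relations and from Coxeter relations. -/
def saturate (S : List ℕ) (steps : List (List OctagonStep)) (K : ℕ) : ℕ :=
  strictFold (fun K l => sweep (deduceRow S) (strictFold deduceOctagon l K)) steps K

/-- Whether a coset is attached to `w₀` and all edges are known. -/
def complete (S : List ℕ) (w₀ K : ℕ) : Bool :=
  known K w₀ 15 && (List.range 256).all fun w => !known K w 15 ||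
    S.all fun s => known K w s && known K (act s w) 15

theorem strictFold_cons {α : Type*} (f : ℕ → α → ℕ) (a : α) (l : List α) (K : ℕ) :
    strictFold f (a :: l) K = strictFold f l (f K a) := by
  rw [strictFold]
  cases f K a <;> rfl

theorem strictFold_induction {α : Type*} {f : ℕ → α → ℕ} {I : ℕ → Prop} {l : List α}
    (h : ∀ K, ∀ a ∈ l, I K → I (f K a)) {K : ℕ} (hK : I K) : I (strictFold f l K) := by
  induction l generalizing K with
  | nil => exact hK
  | cons a l ih =>
    rw [strictFold_cons]
    exact ih (fun K b hb => h K b (List.mem_cons_of_mem _ hb)) (h K a List.mem_cons_self hK)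

theorem sweep_induction {f : ℕ → ℕ → ℕ} {I : ℕ → Prop}
    (h : ∀ K w, known K w 15 = true → I K → I (f K w)) {K : ℕ} (hK : I K) : I (sweep f K) := by
  refine strictFold_induction (fun K w _ hK => ?_) hK
  cases hw : known K w 15
  · exact hK
  · exact h K w hw hK

theorem known_or_shiftLeft {K a w s : ℕ} :
    known (K ||| 1 <<< a) w s = true ↔ known K w s = true ∨ a = 16 * w + s := by
  simp [known, Nat.testBit_or, Nat.one_shiftLeft, Nat.testBit_two_pow]

theorem known_insertEdge {K w s v t : ℕ} (hs : s < 16) (ht : t < 16) :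
    known (insertEdge K w s) v t = true ↔
      known K v t = true ∨ t = s ∧ (v = w ∨ v = act s w) := by
  have : known (insertEdge K w s) v t = true ↔
      known K v t = true ∨ 16 * w + s = 16 * v + t ∨ 16 * act s w + s = 16 * v + t := by
    simp [insertEdge, known, Nat.testBit_or, Nat.one_shiftLeft, Nat.testBit_two_pow]
  rw [this]
  refine or_congr Iff.rfl ⟨fun h => ?_, fun h => ?_⟩ <;> omega

/-! ### Soundness of the coset enumeration -/

section Soundness

variable {H : Subgroup FanoDeflation} {x : ℕ → FanoDeflation ⧸ H}

/-- The recorded edges are correct for the cosets `x w` attached to the codes `w`. -/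
def EdgesHold (x : ℕ → FanoDeflation ⧸ H) (K : ℕ) : Prop :=
  ∀ w s, s < 14 → known K w s = true → x (act s w) = gen s • x w

theorem gen_mul_self (s : ℕ) : gen s * gen s = 1 :=
  congrArg (QuotientGroup.mk' (deflationSubgroup incP2))
    ((coxeterMatrix incP2).toCoxeterSystem.simple_mul_simple_self (node s))

theorem gen_inv (s : ℕ) : (gen s)⁻¹ = gen s := inv_eq_of_mul_eq_one_left (gen_mul_self s)

theorem gen_mul_gen_pow (s t : ℕ) :
    (gen s * gen t) ^ coxeterMatrix incP2 (node s) (node t) = 1 :=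
  congrArg (QuotientGroup.mk' (deflationSubgroup incP2))
    ((coxeterMatrix incP2).toCoxeterSystem.simple_mul_simple_pow (node s) (node t))

theorem EdgesHold.insertEdge {K w s : ℕ} (h : EdgesHold x K) (hs : s < 14)
    (hw : x (act s w) = gen s • x w) : EdgesHold x (insertEdge K w s) := by
  intro v t ht hv
  rcases (known_insertEdge (by omega) (by omega)).1 hv with hv | ⟨rfl, rfl | rfl⟩
  · exact h v t ht hv
  · exact hw
  · rw [act_act, hw, smul_smul, gen_mul_self, one_smul]

theorem EdgesHold.of_follows {K w u : ℕ} {l : List ℕ} (h : EdgesHold x K)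
    (hl : ∀ t ∈ l, t < 14) (hf : follows K w l u = true) :
    x u = ((l.map gen).prod)⁻¹ • x w := by
  induction l generalizing w with
  | nil =>
    rw [show w = u by simpa [follows] using hf]
    simp
  | cons t l ih =>
    have hstep : known K w t = true ∧ follows K (act t w) l u = true := by
      rw [follows] at hf
      cases hk : known K w t
      · simp [hk] at hf
      · rw [hk, cond_true] at hf
        refine ⟨rfl, ?_⟩
        cases ha : act t w <;> rw [ha] at hf <;> exact hf
    rw [ih (fun s hs => hl s (List.mem_cons_of_mem _ hs)) hstep.2,
      h w t (hl t List.mem_cons_self) hstep.1, smul_smul, List.map_cons, List.prod_cons,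
      mul_inv_rev, gen_inv]

theorem prod_coxeterWord {s t : ℕ} (hs : s < 14) (ht : t < 14) :
    ((coxeterWord s t).map gen).prod = gen s := by
  have key (a : ℕ) (g : FanoDeflation) : gen a * (gen a * g) = g := by
    rw [← mul_assoc, gen_mul_self, one_mul]
  by_cases hst : s = t
  · subst hst
    have hadj : adj s s = false := by
      rw [adj, Nat.xor_self]
      rfl
    simp [coxeterWord, hadj, key]
  · have h := gen_mul_gen_pow t s
    have hne : ¬ node t = node s := fun h => hst (node_injOn ht hs h).symm
    rw [coxeterMatrix_apply, if_neg hne] at h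
    have hadj := (SimpleGraph.adj_comm _ _ _).trans (incP2_adj_node hs ht)
    by_cases ha : adj s t = true
    · rw [if_pos (hadj.2 ha)] at h
      simp only [pow_succ, pow_zero, one_mul, mul_assoc] at h
      simp only [coxeterWord, ha, cond_true, List.map_cons, List.map_nil, List.prod_cons,
        List.prod_nil, mul_one]
      rw [← mul_left_inj (gen s), gen_mul_self]
      simpa only [mul_assoc] using h
    · rw [if_neg fun k => ha (hadj.1 k)] at h
      simp only [pow_succ, pow_zero, one_mul, mul_assoc] at h
      simp only [coxeterWord, Bool.eq_false_iff.2 ha, cond_false, List.map_cons, List.map_nil,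
        List.prod_cons, List.prod_nil, mul_one]
      rw [← mul_left_inj (gen s), gen_mul_self]
      simpa only [mul_assoc] using h

theorem lt_of_mem_coxeterWord {s t a : ℕ} (hs : s < 14) (ht : t < 14)
    (ha : a ∈ coxeterWord s t) : a < 14 := by
  rw [coxeterWord] at ha
  cases hst : adj s t <;> simp [hst] at ha <;> omega

theorem EdgesHold.deduce {T : List ℕ} {K w s : ℕ} (h : EdgesHold x K) (hT : ∀ t ∈ T, t < 14)
    (hs : s < 14) : EdgesHold x (deduce T K w s) := by
  rw [Deflation.deduce]
  cases known K w s
  swap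
  · exact h
  rw [cond_false]
  cases hany : T.any fun t => follows K w (coxeterWord s t) (act s w)
  · exact h
  obtain ⟨t, ht, hf⟩ := List.any_eq_true.1 hany
  refine h.insertEdge hs ?_
  rw [h.of_follows (fun a => lt_of_mem_coxeterWord hs (hT t ht)) hf, prod_coxeterWord hs (hT t ht),
    gen_inv]

theorem EdgesHold.deduceRow {S : List ℕ} {K w : ℕ} (h : EdgesHold x K) (hS : ∀ t ∈ S, t < 14) :
    EdgesHold x (deduceRow S K w) :=
  strictFold_induction (fun _ s hs hK =>
    hK.deduce (fun t ht => hS t (List.mem_filter.1 ht).1) (hS s hs)) h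

/-- The sequence of nodes is a free octagon of the incidence graph. -/
def IsOctagon (o : Fin 8 → ℕ) : Prop :=
  ∀ i j, o i < 14 ∧ (o i = o j → i = j) ∧
    (adj (o i) (o j) = true ↔ (SimpleGraph.cycleGraph 8).Adj i j)

instance (o : Fin 8 → ℕ) : Decidable (IsOctagon o) := by
  unfold IsOctagon
  infer_instance

theorem IsOctagon.prod_octagonWord {o : Fin 8 → ℕ} (h : IsOctagon o) (j : ℕ) :
    ((octagonWord o j).map gen).prod = 1 := by
  let f : SimpleGraph.cycleGraph 8 ↪g incP2 :=
    { toFun := fun i => node (o i)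
      inj' := fun i j hij => (h i j).2.1 (node_injOn (h i j).1 (h j i).1 hij)
      map_rel_iff' := fun {i j} => (incP2_adj_node (h i j).1 (h j i).1).trans (h i j).2.2 }
  rw [octagonWord, List.map_rotate, List.map_map]
  exact List.prod_rotate_eq_one_of_prod_eq_one (prod_octagon_eq_one f) j

theorem EdgesHold.deduceOctagon {p : OctagonStep} {K : ℕ} (h : EdgesHold x K)
    (hp : IsOctagon p.octagon) : EdgesHold x (deduceOctagon K p) := by
  have hprod := hp.prod_octagonWord p.rotation
  have hlt : ∀ t ∈ octagonWord p.octagon p.rotation, t < 14 := by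
    intro t ht
    rw [octagonWord, List.mem_rotate, List.mem_map] at ht
    obtain ⟨i, -, rfl⟩ := ht
    exact (hp i i).1
  rw [Deflation.deduceOctagon]
  cases hw : octagonWord p.octagon p.rotation with
  | nil => exact h
  | cons s l =>
    rw [hw] at hprod hlt
    change EdgesHold x (bif follows K p.code l (act s p.code) then _ else _)
    cases hf : follows K p.code l (act s p.code)
    · exact h
    · refine h.insertEdge (hlt s List.mem_cons_self) ?_
      rw [h.of_follows (fun t ht => hlt t (List.mem_cons_of_mem _ ht)) hf]
      rw [List.map_cons, List.prod_cons, mul_eq_one_iff_eq_inv] at hprod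
      rw [← hprod]

theorem EdgesHold.saturate {S : List ℕ} {steps : List (List OctagonStep)} {K : ℕ}
    (h : EdgesHold x K) (hS : ∀ t ∈ S, t < 14)
    (hsteps : ∀ l ∈ steps, ∀ p ∈ l, IsOctagon p.octagon) : EdgesHold x (saturate S steps K) :=
  strictFold_induction (fun _ l hl hK => sweep_induction (fun _ _ _ hK => hK.deduceRow hS)
    (strictFold_induction (fun _ p hp hK => hK.deduceOctagon (hsteps l hl p hp)) hK)) h

/-- Cosets can be attached to the codes in such a way that all recorded edges are correct and
`w₀` belongs to the trivial coset. -/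
def IsConsistent (H : Subgroup FanoDeflation) (w₀ K : ℕ) : Prop :=
  known K w₀ 15 = true ∧
  (∀ w s, s < 14 → known K w s = true → known K w 15 = true ∧ known K (act s w) 15 = true) ∧
  ∃ x : ℕ → FanoDeflation ⧸ H, x w₀ = ((1 : FanoDeflation) : FanoDeflation ⧸ H) ∧ EdgesHold x K

/-- The loops at w₀ are correct because the generators in S lie in H and therefore fix the trivial
coset. -/
theorem isConsistent_start {S : List ℕ} {w₀ : ℕ} (hS : ∀ s ∈ S, s < 14 ∧ act s w₀ = w₀)
    (hH : ∀ s ∈ S, gen s ∈ H) : IsConsistent H w₀ (start S w₀) := by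
  have hone : ∀ w s, known (1 <<< (16 * w₀ + 15)) w s = true ↔ 16 * w₀ + 15 = 16 * w + s := by
    intro w s
    rw [← Nat.zero_or (1 <<< (16 * w₀ + 15)), known_or_shiftLeft]
    simp [known]
  refine strictFold_induction (I := IsConsistent H w₀) (fun K s hs hK => ?_) ?_
  · obtain ⟨h1, h2, x, hx, h3⟩ := hK
    obtain ⟨hs14, hfix⟩ := hS s hs
    refine ⟨known_or_shiftLeft.2 (.inl h1), fun w t ht hw => ?_, x, hx, fun w t ht hw => ?_⟩
    · rcases known_or_shiftLeft.1 hw with hw | hw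
      · exact (h2 w t ht hw).imp (fun h => known_or_shiftLeft.2 (.inl h))
          fun h => known_or_shiftLeft.2 (.inl h)
      · obtain ⟨rfl, rfl⟩ : w = w₀ ∧ t = s := by omega
        rw [hfix]
        exact ⟨known_or_shiftLeft.2 (.inl h1), known_or_shiftLeft.2 (.inl h1)⟩
    · rcases known_or_shiftLeft.1 hw with hw | hw
      · exact h3 w t ht hw
      · obtain ⟨rfl, rfl⟩ : w = w₀ ∧ t = s := by omega
        rw [hfix, hx, MulAction.Quotient.smul_coe, QuotientGroup.eq]
        simpa using hH t hs
  · refine ⟨(hone _ _).2 rfl, fun w t ht hw => ?_,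
      fun _ => ((1 : FanoDeflation) : FanoDeflation ⧸ H), rfl, fun w t ht hw => ?_⟩
    · have := (hone _ _).1 hw
      omega
    · have := (hone _ _).1 hw
      omega

theorem IsConsistent.grow {w₀ K w s : ℕ} (h : IsConsistent H w₀ K) (hs : s < 14) :
    IsConsistent H w₀ (grow K w s) := by
  rw [Deflation.grow]
  cases hc : known K w 15 && !known K (act s w) 15
  · exact h
  rw [cond_true]
  obtain ⟨h1, h2, x, hx, h3⟩ := h
  simp only [Bool.and_eq_true, Bool.not_eq_true', Bool.eq_false_iff] at hc
  obtain ⟨hw, hsw⟩ := hc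
  set K' := K ||| 1 <<< (16 * act s w + 15) with hK'
  have hmono {v t : ℕ} (hv : known K v t = true) : known K' v t = true :=
    known_or_shiftLeft.2 (.inl hv)
  have hnew : known K' (act s w) 15 = true := known_or_shiftLeft.2 (.inr rfl)
  have hold {v t : ℕ} (ht : t < 14) (hv : known K' v t = true) : known K v t = true := by
    rcases known_or_shiftLeft.1 hv with hv | hv
    · exact hv
    · omega
  have hins {v t : ℕ} (ht : t < 16) (hv : known K' v t = true) :
      known (insertEdge K' w s) v t = true := (known_insertEdge (by omega) ht).2 (.inl hv)
  -- The new code receives the coset `gen s • x w`. Recorded edges join only codes that already have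
  -- a coset, so changing x there leaves them correct.
  refine ⟨hins (by omega) (hmono h1), fun v t ht hv => ?_,
    Function.update x (act s w) (gen s • x w), ?_, ?_⟩
  · rcases (known_insertEdge (by omega) (by omega)).1 hv with hv | ⟨rfl, rfl | rfl⟩
    · exact (h2 v t ht (hold ht hv)).imp (fun h => hins (by omega) (hmono h))
        fun h => hins (by omega) (hmono h)
    · exact ⟨hins (by omega) (hmono hw), hins (by omega) hnew⟩
    · rw [act_act]
      exact ⟨hins (by omega) hnew, hins (by omega) (hmono hw)⟩
  · rw [Function.update_of_ne, hx]
    rintro rfl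
    exact hsw h1
  · refine EdgesHold.insertEdge (fun v t ht hv => ?_) hs ?_
    · obtain ⟨hv1, hv2⟩ := h2 v t ht (hold ht hv)
      rw [Function.update_of_ne, Function.update_of_ne, h3 v t ht (hold ht hv)]
      · rintro rfl
        exact hsw hv1
      · intro heq
        exact hsw (heq ▸ hv2)
    · rw [Function.update_self, Function.update_of_ne]
      intro heq
      exact hsw (heq ▸ hw)

theorem IsConsistent.explore {S : List ℕ} {n w₀ K : ℕ} (h : IsConsistent H w₀ K)
    (hS : ∀ t ∈ S, t < 14) : IsConsistent H w₀ (explore S n K) :=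
  strictFold_induction (fun _ _ _ hK => sweep_induction (fun _ _ _ hK =>
    strictFold_induction (fun _ s hs hK => hK.grow (hS s hs)) hK) hK) h

end Soundness

/-! ### Injectivity along a chain of parabolic subgroups -/

/-- The subgroup of the deflated group generated by a list of nodes. -/
noncomputable def parabolic (S : List ℕ) : Subgroup FanoDeflation :=
  Subgroup.closure (gen '' {s | s ∈ S})

theorem gen_mem_parabolic {S : List ℕ} {s : ℕ} (hs : s ∈ S) : gen s ∈ parabolic S :=
  Subgroup.subset_closure ⟨s, hs, rfl⟩

theorem parabolic_induction {S : List ℕ} {p : FanoDeflation → Prop} (one : p 1)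
    (mul : ∀ s ∈ S, ∀ g, p g → p (gen s * g)) {g : FanoDeflation} (hg : g ∈ parabolic S) : p g := by
  refine Subgroup.closure_induction_left (p := fun g _ => p g) one ?_ ?_ hg
  · rintro _ ⟨s, hs, rfl⟩ g _ h
    exact mul s hs g h
  · rintro _ ⟨s, hs, rfl⟩ g _ h
    rw [gen_inv]
    exact mul s hs g h

/-- The state reached after the enumeration of the cosets of the subgroup generated by `T` in the
group generated by `S`, where the coset of `T` is attached to the code `w₀`. -/
def enumeration (S T : List ℕ) (w₀ n : ℕ) (steps : List (List OctagonStep)) : ℕ :=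
  saturate S steps (explore S n (start T w₀))

/-- If the enumeration of cosets is complete, then the stabilizer of the initial vector is
contained in the smaller subgroup. -/
theorem mem_parabolic_of_complete {S T : List ℕ} {w₀ n : ℕ} {steps : List (List OctagonStep)}
    (hcomplete : complete S w₀ (enumeration S T w₀ n steps) = true)
    (hw₀ : w₀ < 256) (hS : ∀ s ∈ S, s < 14) (hT : ∀ s ∈ T, s < 14 ∧ act s w₀ = w₀)
    (hsteps : ∀ l ∈ steps, ∀ p ∈ l, IsOctagon p.octagon)
    {g : FanoDeflation} (hg : g ∈ parabolic S)
    (hfix : (reflectionHom g : (Fin 8 → ZMod 2) ≃ₗ[ZMod 2] (Fin 8 → ZMod 2)) (decode w₀) =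
      decode w₀) : g ∈ parabolic T := by
  obtain ⟨-, -, x, hx, hedges⟩ := (isConsistent_start (H := parabolic T) hT
    fun s hs => gen_mem_parabolic hs).explore (n := n) hS
  replace hedges : EdgesHold x (enumeration S T w₀ n steps) := hedges.saturate hS hsteps
  set K := enumeration S T w₀ n steps
  obtain ⟨hvisited, hcomplete⟩ := Bool.and_eq_true_iff.1 hcomplete
  have hclosed {w s : ℕ} (hw : w < 256) (hwK : known K w 15 = true) (hs : s ∈ S) :
      known K w s = true ∧ known K (act s w) 15 = true := by
    have := List.all_eq_true.1 hcomplete w (List.mem_range.2 hw)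
    rw [hwK, Bool.not_true, Bool.false_or] at this
    exact Bool.and_eq_true_iff.1 (List.all_eq_true.1 this s hs)
  -- Along a word for g, the coset attached to the code of g applied to w₀ is the coset of g. If g
  -- fixes w₀, this is the trivial coset.
  have key : ∃ w < 256, known K w 15 = true ∧ x w = (g : FanoDeflation ⧸ parabolic T) ∧
      (reflectionHom g : (Fin 8 → ZMod 2) ≃ₗ[ZMod 2] (Fin 8 → ZMod 2)) (decode w₀) =
        decode w := by
    clear hfix
    refine parabolic_induction (p := fun g => ∃ w < 256, known K w 15 = true ∧
      x w = (g : FanoDeflation ⧸ parabolic T) ∧ (reflectionHom g :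
        (Fin 8 → ZMod 2) ≃ₗ[ZMod 2] (Fin 8 → ZMod 2)) (decode w₀) = decode w) ?_ ?_ hg
    · exact ⟨w₀, hw₀, hvisited, hx, by simp⟩
    · rintro s hs g ⟨w, hw, hwK, hxw, hgw⟩
      obtain ⟨h1, h2⟩ := hclosed hw hwK hs
      refine ⟨act s w, act_lt hw, h2, ?_, ?_⟩
      · rw [hedges w s (hS s hs) h1, hxw]
        rfl
      · rw [map_mul, Subgroup.coe_mul, LinearEquiv.mul_apply, hgw,
          reflectionHom_gen_decode (hS s hs) hw]
  obtain ⟨w, hw, -, hxw, hgw⟩ := key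
  obtain rfl := decode_injOn hw hw₀ (hgw.symm.trans hfix)
  rw [hx, QuotientGroup.eq] at hxw
  simpa using hxw

/-- The places where octagon relations enter into the enumeration of the cosets of the Coxeter
group of type `E₇` in the deflated group. -/
def octagonSteps : List (List OctagonStep) :=
  [[],
   [⟨97, ![7, 3, 9, 2, 10, 0, 12, 5], 6⟩,
    ⟨84, ![3, 7, 1, 11, 4, 13, 2, 9], 6⟩],
   [⟨170, ![12, 6, 9, 3, 8, 4, 13, 5], 13⟩,
    ⟨50, ![10, 1, 7, 3, 8, 4, 13, 2], 13⟩,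
    ⟨35, ![2, 13, 4, 8, 3, 7, 1, 10], 13⟩],
   [⟨65, ![0, 10, 2, 13, 5, 7, 3, 8], 6⟩,
    ⟨46, ![0, 12, 6, 9, 2, 13, 4, 8], 6⟩,
    ⟨101, ![13, 4, 8, 0, 10, 1, 7, 5], 6⟩,
    ⟨19, ![7, 3, 8, 0, 10, 2, 13, 5], 13⟩,
    ⟨53, ![10, 1, 11, 4, 8, 3, 9, 2], 10⟩,
    ⟨119, ![1, 10, 0, 8, 3, 9, 6, 11], 6⟩],
   [⟨105, ![12, 6, 9, 2, 13, 4, 8, 0], 1⟩,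
    ⟨149, ![7, 3, 8, 4, 11, 6, 12, 5], 7⟩,
    ⟨159, ![2, 13, 4, 11, 1, 7, 3, 9], 8⟩,
    ⟨193, ![9, 3, 7, 1, 10, 0, 12, 6], 1⟩,
    ⟨152, ![2, 10, 1, 7, 3, 8, 4, 13], 7⟩],
   [⟨56, ![11, 6, 9, 3, 8, 0, 10, 1], 13⟩,
    ⟨80, ![8, 4, 13, 5, 7, 1, 10, 0], 3⟩],
   []]

theorem isOctagon_octagonSteps : ∀ l ∈ octagonSteps, ∀ p ∈ l, IsOctagon p.octagon := by
  decide +kernel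

/-- The code 119 is `vec 13`, and its orbit consists of the 136 nonsingular vectors. The seven nodes
are not joined to node 13 and form a diagram of type E₇ with centre 3 and arms 9, 8–0 and 7–1–11. -/
theorem complete_enumeration_octagonSteps :
    complete (List.range 14) 119
      (enumeration (List.range 14) [0, 1, 3, 7, 8, 9, 11] 119 4 octagonSteps) = true := by
  decide +kernel

theorem mem_parabolic_of_complete_of_coxeter {S T : List ℕ} {w₀ n m : ℕ}
    (hcomplete : complete S w₀ (enumeration S T w₀ n (List.replicate m [])) = true)
    (hw₀ : w₀ < 256) (hS : ∀ s ∈ S, s < 14) (hT : ∀ s ∈ T, s < 14 ∧ act s w₀ = w₀)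
    {g : FanoDeflation} (hg : g ∈ parabolic S) (h1 : reflectionHom g = 1) : g ∈ parabolic T := by
  refine mem_parabolic_of_complete hcomplete hw₀ hS hT (fun l hl p hp => ?_) hg (by simp [h1])
  rw [List.eq_of_mem_replicate hl] at hp
  exact absurd hp List.not_mem_nil

theorem parabolic_range : parabolic (List.range 14) = ⊤ := by
  rw [eq_top_iff]
  rintro g -
  obtain ⟨w, rfl⟩ := QuotientGroup.mk_surjective g
  induction w using (coxeterMatrix incP2).toCoxeterSystem.simple_induction_left with
  | one => exact one_mem _
  | mul_simple_left w n ih =>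
    obtain ⟨s, hs, rfl⟩ := exists_node_eq n
    exact mul_mem (gen_mem_parabolic (List.mem_range.2 hs)) ih

theorem parabolic_nil : parabolic [] = ⊥ := by
  simp [parabolic]

theorem reflectionHom_injective : Function.Injective reflectionHom := by
  rw [injective_iff_map_eq_one]
  intro g hg
  have h0 : g ∈ parabolic (List.range 14) := parabolic_range ▸ Subgroup.mem_top g
  have h1 : g ∈ parabolic [0, 1, 3, 7, 8, 9, 11] :=
    mem_parabolic_of_complete complete_enumeration_octagonSteps (by norm_num)
      (fun s hs => List.mem_range.1 hs) (by decide) isOctagon_octagonSteps h0 (by simp [hg])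
  -- From here on the nodes 11, 0, 8, 9, 3, 7, 1 are removed in turn, giving types E₆, D₅, A₄, A₃,
  -- A₂, A₁ and the trivial group. Each w₀ is fixed by the remaining nodes, and the orbits have
  -- sizes 56, 27, 16, 5, 4, 3, 2.
  have h2 : g ∈ parabolic [0, 1, 3, 7, 8, 9] :=
    mem_parabolic_of_complete_of_coxeter (w₀ := 32) (n := 14) (m := 11) (by decide +kernel)
      (by norm_num) (by decide) (by decide) h1 hg
  have h3 : g ∈ parabolic [1, 3, 7, 8, 9] :=
    mem_parabolic_of_complete_of_coxeter (w₀ := 9) (n := 8) (m := 7) (by decide +kernel)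
      (by norm_num) (by decide) (by decide) h2 hg
  have h4 : g ∈ parabolic [1, 3, 7, 9] :=
    mem_parabolic_of_complete_of_coxeter (w₀ := 3) (n := 5) (m := 4) (by decide +kernel)
      (by norm_num) (by decide) (by decide) h3 hg
  have h5 : g ∈ parabolic [1, 3, 7] :=
    mem_parabolic_of_complete_of_coxeter (w₀ := 16) (n := 3) (m := 2) (by decide +kernel)
      (by norm_num) (by decide) (by decide) h4 hg
  have h6 : g ∈ parabolic [1, 7] :=
    mem_parabolic_of_complete_of_coxeter (w₀ := 128) (n := 3) (m := 2) (by decide +kernel)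
      (by norm_num) (by decide) (by decide) h5 hg
  have h7 : g ∈ parabolic [1] :=
    mem_parabolic_of_complete_of_coxeter (w₀ := 4) (n := 2) (m := 1) (by decide +kernel)
      (by norm_num) (by decide) (by decide) h6 hg
  have h8 : g ∈ parabolic [] :=
    mem_parabolic_of_complete_of_coxeter (w₀ := 1) (n := 2) (m := 1) (by decide +kernel)
      (by norm_num) (by decide) (by decide) h7 hg
  rwa [parabolic_nil, Subgroup.mem_bot] at h8

/-! ### Surjectivity: reflections generate the orthogonal group -/

/-- The vector space on which the quadratic form of minus type lives. -/
abbrev MinusSpace : Type := Fin 8 → ZMod 2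

/-- The exploration is reused as a mere orbit search from `vec 0`. Each newly reached vector is the
image of an earlier one under a generator, so its reflection is a conjugate of one already in the
range. -/
theorem reflection_mem_range_of_known {n w : ℕ}
    (hw : known (explore (List.range 14) n (start [] (vec 0))) w 15 = true) :
    w < 256 ∧ reflection minusForm (decode w) ∈ reflectionHom.range := by
  let I (K : ℕ) : Prop := ∀ w, known K w 15 = true →
    w < 256 ∧ reflection minusForm (decode w) ∈ reflectionHom.range
  have hstart : I (start [] (vec 0)) := by
    intro w hw
    have hw : vec 0 = w := by
      simpa [start, strictFold, known, Nat.one_shiftLeft, Nat.testBit_two_pow] using hw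
    rw [← hw]
    exact ⟨vec_lt 0, gen 0, reflectionHom_gen (by norm_num)⟩
  have hgrow (K v s : ℕ) (hs : s < 14) (hK : I K) : I (grow K v s) := by
    rw [grow]
    cases hc : known K v 15 && !known K (act s v) 15
    · exact hK
    rw [cond_true]
    intro w hw
    obtain ⟨hv, hr⟩ := hK v (Bool.and_eq_true_iff.1 hc).1
    rcases (known_insertEdge (by omega) (by norm_num)).1 hw with hw | ⟨h, -⟩
    · rcases known_or_shiftLeft.1 hw with hw | hw
      · exact hK w hw
      · obtain rfl : act s v = w := by omega
        refine ⟨act_lt hv, ?_⟩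
        rw [← reflection_decode hs hv, ← conj_reflection, ← reflectionHom_gen hs]
        exact mul_mem (mul_mem ⟨_, rfl⟩ hr) (inv_mem ⟨_, rfl⟩)
    · omega
  exact strictFold_induction (I := I) (fun _ _ _ hK => sweep_induction (fun _ _ _ hK =>
    strictFold_induction (fun _ s hs hK => hgrow _ _ s (List.mem_range.1 hs) hK) hK) hK)
    hstart w hw

theorem known_of_quad : ∀ w < 256, quad w = true →
    known (explore (List.range 14) 4 (start [] (vec 0))) w 15 = true := by
  decide +kernel

theorem reflection_mem_range (u : MinusSpace) :
    reflection minusForm u ∈ reflectionHom.range := by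
  obtain ⟨w, hw, rfl⟩ := exists_decode_eq u
  cases hq : quad w
  · rw [reflection, dif_neg]
    · exact one_mem _
    · rw [minusForm_decode hw, hq]
      decide
  · exact (reflection_mem_range_of_known (known_of_quad w hw hq)).2

/-- A basis of `𝔽₂⁸` consisting of nonsingular vectors. -/
def basisCode (k : ℕ) : ℕ := (0xa04056138807a903 >>> (8 * k)) % 256

theorem basisCode_lt (k : ℕ) : basisCode k < 256 := Nat.mod_lt _ (by norm_num)

theorem quad_basisCode : ∀ k < 8, quad (basisCode k) = true := by decide

/-- The value of the polar form on the vectors with given codes. -/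
def pairing (a b : ℕ) : Bool := quad (a ^^^ b) ^^ quad a ^^ quad b

/-- Whether a vector is nonsingular and has the same inner products as the `k`-th basis vector
with the preceding ones. -/
def similar (k w : ℕ) : Bool :=
  quad w && (List.range k).all fun j =>
    pairing w (basisCode j) == pairing (basisCode k) (basisCode j)

/-- Any candidate for the image of the k-th basis vector is joined to that vector by at most two
steps between nonorthogonal candidates; each step is realized by one reflection. -/
theorem similar_connected : ∀ k < 8, ∀ w < 256, similar k w = true →
    w = basisCode k ∨ pairing w (basisCode k) = true ∨
      ∃ y < 256, similar k y = true ∧ pairing w y = true ∧ pairing y (basisCode k) = true := by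
  decide +kernel

theorem eq_zero_of_pairing : ∀ w < 256, (∀ k < 8, pairing w (basisCode k) = false) → w = 0 := by
  decide +kernel

theorem polar_decode_eq {a b : ℕ} (ha : a < 256) (hb : b < 256) :
    QuadraticMap.polar minusForm (decode a) (decode b) = if pairing a b then 1 else 0 :=
  polar_decode ha hb

theorem pairing_iff {a b : ℕ} (ha : a < 256) (hb : b < 256) :
    pairing a b = true ↔ QuadraticMap.polar minusForm (decode a) (decode b) = 1 := by
  rw [polar_decode_eq ha hb]
  cases pairing a b <;> decide

theorem quad_iff {a : ℕ} (ha : a < 256) : quad a = true ↔ minusForm (decode a) = 1 := by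
  rw [minusForm_decode ha]
  cases quad a <;> decide

theorem similar_iff {k w : ℕ} (hw : w < 256) : similar k w = true ↔
    minusForm (decode w) = 1 ∧ ∀ j < k,
      QuadraticMap.polar minusForm (decode w) (decode (basisCode j)) =
        QuadraticMap.polar minusForm (decode (basisCode k)) (decode (basisCode j)) := by
  simp only [similar, Bool.and_eq_true, quad_iff hw, List.all_eq_true, List.mem_range, beq_iff_eq]
  refine and_congr Iff.rfl (forall₂_congr fun j _ => ?_)
  rw [polar_decode_eq hw (basisCode_lt j), polar_decode_eq (basisCode_lt k) (basisCode_lt j)]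
  cases pairing w (basisCode j) <;> cases pairing (basisCode k) (basisCode j) <;> decide

/-- The reflection in the sum of two nonorthogonal nonsingular vectors exchanges them, and fixes
the vectors that have equal inner products with both. -/
theorem reflection_add {V : Type*} [AddCommGroup V] [Module (ZMod 2) V]
    {Q : QuadraticForm (ZMod 2) V} {a b : V} (ha : Q a = 1) (hb : Q b = 1)
    (hab : QuadraticMap.polar Q a b = 1) :
    (reflection Q (a + b) : V ≃ₗ[ZMod 2] V) a = b ∧
      ∀ c, QuadraticMap.polar Q a c = QuadraticMap.polar Q b c →
        (reflection Q (a + b) : V ≃ₗ[ZMod 2] V) c = c := by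
  have hq : Q (a + b) = 1 := by
    rw [QuadraticMap.map_add Q, ha, hb, hab]
    decide
  refine ⟨?_, fun c hc => ?_⟩
  · rw [reflection_apply hq, QuadraticMap.polar_add_right, polar_self_eq_zero, hab, zero_add,
      one_smul, ← add_assoc, zmod_two_add_self, zero_add]
  · rw [reflection_apply hq, QuadraticMap.polar_add_right, QuadraticMap.polar_comm, hc,
      QuadraticMap.polar_comm Q c b, ← two_mul, show (2 : ZMod 2) = 0 from rfl, zero_mul, zero_smul,
      add_zero]

/-- Inductive step of the Witt type argument: at most two reflections move the image of the k-th
basis vector back. They are taken in sums of similar vectors, hence fix the preceding basis vectors.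
-/
theorem exists_mem_range_fixing {k : ℕ} (hk : k < 8) (g : isometryGroup minusForm)
    (hg : ∀ j < k, (g : MinusSpace ≃ₗ[ZMod 2] MinusSpace) (decode (basisCode j)) =
      decode (basisCode j)) :
    ∃ h ∈ reflectionHom.range, ∀ j < k + 1,
      ((h * g : isometryGroup minusForm) : MinusSpace ≃ₗ[ZMod 2] MinusSpace)
        (decode (basisCode j)) = decode (basisCode j) := by
  obtain ⟨w, hw, hwg⟩ := exists_decode_eq
    ((g : MinusSpace ≃ₗ[ZMod 2] MinusSpace) (decode (basisCode k)))
  have hb1 : minusForm (decode (basisCode k)) = 1 :=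
    (quad_iff (basisCode_lt k)).1 (quad_basisCode k hk)
  have hw1 : minusForm (decode w) = 1 := by rw [hwg, g.2, hb1]
  have hwp : ∀ j < k, QuadraticMap.polar minusForm (decode w) (decode (basisCode j)) =
      QuadraticMap.polar minusForm (decode (basisCode k)) (decode (basisCode j)) := by
    intro j hj
    conv_lhs => rw [hwg, ← hg j hj]
    exact polar_isometry g _ _
  have main : ∃ h ∈ reflectionHom.range,
      (h : MinusSpace ≃ₗ[ZMod 2] MinusSpace) (decode w) = decode (basisCode k) ∧
      ∀ j < k, (h : MinusSpace ≃ₗ[ZMod 2] MinusSpace) (decode (basisCode j)) =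
        decode (basisCode j) := by
    rcases similar_connected k hk w hw ((similar_iff hw).2 ⟨hw1, hwp⟩) with
      h | h | ⟨y, hy, hs, h, h'⟩
    · exact ⟨1, one_mem _, by rw [h]; rfl, fun j _ => rfl⟩
    · have hr := reflection_add hw1 hb1 ((pairing_iff hw (basisCode_lt k)).1 h)
      exact ⟨_, reflection_mem_range _, hr.1, fun j hj => hr.2 _ (hwp j hj)⟩
    · obtain ⟨hy1, hyp⟩ := (similar_iff hy).1 hs
      have hr := reflection_add hw1 hy1 ((pairing_iff hw hy).1 h)
      have hr' := reflection_add hy1 hb1 ((pairing_iff hy (basisCode_lt k)).1 h')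
      refine ⟨_, mul_mem (reflection_mem_range (decode y + decode (basisCode k)))
        (reflection_mem_range (decode w + decode y)), ?_, fun j hj => ?_⟩
      · rw [Subgroup.coe_mul, LinearEquiv.mul_apply, hr.1, hr'.1]
      · rw [Subgroup.coe_mul, LinearEquiv.mul_apply,
          hr.2 _ ((hwp j hj).trans (hyp j hj).symm), hr'.2 _ (hyp j hj)]
  obtain ⟨h, hh, h1, h2⟩ := main
  refine ⟨h, hh, fun j hj => ?_⟩
  rw [Subgroup.coe_mul, LinearEquiv.mul_apply]
  rcases Nat.lt_succ_iff_lt_or_eq.1 hj with hj | rfl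
  · rw [hg j hj, h2 j hj]
  · rw [← hwg, h1]

theorem eq_one_of_fixing (g : isometryGroup minusForm)
    (hg : ∀ j < 8, (g : MinusSpace ≃ₗ[ZMod 2] MinusSpace) (decode (basisCode j)) =
      decode (basisCode j)) : g = 1 := by
  refine Subtype.ext (LinearEquiv.ext fun x => ?_)
  obtain ⟨w, hw, hwx⟩ := exists_decode_eq ((g : MinusSpace ≃ₗ[ZMod 2] MinusSpace) x + x)
  -- Since g preserves B and fixes the basis, g x + x is orthogonal to every basis vector, so it
  -- vanishes by nondegeneracy.
  have hw0 : w = 0 := by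
    refine eq_zero_of_pairing w hw fun k hk => ?_
    have hp := polar_isometry g x (decode (basisCode k))
    rw [hg k hk] at hp
    rw [Bool.eq_false_iff, Ne, pairing_iff hw (basisCode_lt k), hwx, QuadraticMap.polar_add_left,
      hp, ← two_mul, show (2 : ZMod 2) = 0 from rfl, zero_mul]
    decide
  rw [hw0] at hwx
  have h0 : (g : MinusSpace ≃ₗ[ZMod 2] MinusSpace) x + x = 0 := by
    rw [← hwx]
    funext i
    simp [decode]
  rw [← add_right_cancel_iff (a := x), h0]
  exact (zmod_two_add_self x).symm

theorem reflectionHom_surjective : Function.Surjective reflectionHom := by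
  intro g
  have key : ∀ k ≤ 8, ∃ h ∈ reflectionHom.range, ∀ j < k,
      ((h * g : isometryGroup minusForm) : MinusSpace ≃ₗ[ZMod 2] MinusSpace)
        (decode (basisCode j)) = decode (basisCode j) := by
    intro k
    induction k with
    | zero => exact fun _ => ⟨1, one_mem _, fun j hj => absurd hj (Nat.not_lt_zero j)⟩
    | succ k ih =>
      intro hk
      obtain ⟨h, hh, hfix⟩ := ih (by omega)
      obtain ⟨h', hh', hfix'⟩ := exists_mem_range_fixing hk (h * g) hfix
      exact ⟨h' * h, mul_mem hh' hh, by simpa only [mul_assoc] using hfix'⟩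
  obtain ⟨h, hh, hfix⟩ := key 8 le_rfl
  have hg : g = h⁻¹ := eq_inv_of_mul_eq_one_right (eq_one_of_fixing _ hfix)
  exact MonoidHom.mem_range.1 (hg ▸ inv_mem hh)

end Deflation

theorem theorem1 :
    Nonempty (Deflation.DeflatedGroup Deflation.incP2 ≃* Deflation.O8Minus2Colon2) :=
  ⟨MulEquiv.ofBijective Deflation.reflectionHom
    ⟨Deflation.reflectionHom_injective, Deflation.reflectionHom_surjective⟩⟩
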